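/- Let $\mathbb{T}=\{z\in\mathbb{C}:|z|=1\}$; by a measure on $\mathbb{T}$ we mean a finite positive Borel measure, and such a measure is called continuous if it vanishes on every one-point set. For measures $\nu_1,\dots,\nu_n$ on $\mathbb{T}$ let $\nu_1\ast\dots\ast\nu_n$ be their convolution, i.e. the image of $\nu_1\otimes\dots\otimes\nu_n$ under $(z_1,\dots,z_n)\mapsto z_1\cdots z_n$, and let $\sigma^{\ast k}$ be the $k$-fold convolution of $\sigma$ with itself. A measure $\mu$ on $\mathbb{T}$ has the property $CS(n)$ if $\mu\perp\nu_1\ast\dots\ast\nu_n$ for all continuous measures $\nu_1,\dots,\nu_n$ on $\mathbb{T}$. For a measure $\sigma$ on $\mathbb{T}$ let $V_\sigma$ be the unitary operator $(V_\sigma f)(z)=zf(z)$ on $H=L^2(\mathbb{T},\sigma)$, and let $V_\sigma^{\odot n}$ be the restriction of $V_\sigma^{\otimes n}$ to the subspace $H^{\odot n}$ of those elements of the Hilbert space tensor power $H^{\otimes n}$ that are invariant under all permutations of the tensor factors. A unitary operator $U$ of a separable Hilbert space $K$ has simple spectrum if its spectral multiplicity function equals $1$ almost everywhere with respect to its maximal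 spectral type; that is, if there are $x_1,x_2,\dots\in K$ with $K=\bigoplus_{n\ge1}\overline{\mathrm{span}}\{U^jx_n: j\in\mathbb{Z}\}$ (an orthogonal sum) whose spectral measures $\sigma_{x_n}$ (determined by $\langle U^jx_n,x_n\rangle=\int_{\mathbb{T}}z^j\,d\sigma_{x_n}(z)$ for all $j\in\mathbb{Z}$) satisfy $\sigma_{x_1}\gg\sigma_{x_2}\gg\cdots$, and such that for $\sigma_{x_1}$-almost every $z$ exactly one $n$ satisfies $\frac{d\sigma_{x_n}}{d\sigma_{x_1}}(z)\ne0$. Let $\sigma$ be a continuous measure on $\mathbb{T}$. If $V_\sigma^{\odot n}$ has simple spectrum for infinitely many $n\in\mathbb{N}$, then for every $k\ge1$ the measure $\sigma^{\ast k}$ has the property $CS(k+1)$. -/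

import Mathlib

open MeasureTheory
open scoped TensorProduct ComplexConjugate

noncomputable section

/-! ### Measures on the circle group -/

/-- The circle group `𝕋 = {z ∈ ℂ : |z| = 1}` with its Borel `σ`-algebra. -/
instance Circle.instMeasurableSpaceBorel : MeasurableSpace Circle := borel Circle

instance Circle.instBorelSpaceBorel : BorelSpace Circle := ⟨rfl⟩

/-- The convolution `ν₁ ∗ ⋯ ∗ νₙ`: the image of the product measure `ν₁ ⊗ ⋯ ⊗ νₙ` under
`(z₁, …, zₙ) ↦ z₁ ⋯ zₙ`. -/
def circleConv {n : ℕ} (ν : Fin n → Measure Circle) : Measure Circle :=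
  (Measure.pi ν).map (fun z => ∏ i, z i)

/-- The convolution power `σ^{∗k}`. -/
def convPow (σ : Measure Circle) (k : ℕ) : Measure Circle :=
  circleConv (fun _ : Fin k => σ)

/-- The convolution singularity property of order `n`: `σ` is singular with respect to the
convolution of any `n` continuous (that is, vanishing on points) finite measures. -/
def HasCS (σ : Measure Circle) (n : ℕ) : Prop :=
  ∀ ν : Fin n → Measure Circle, (∀ i, IsFiniteMeasure (ν i)) →
    (∀ i, NullSingletonClass (ν i)) → σ ⟂ₘ circleConv ν

/-! ### Tensor powers of a Hilbert space -/

section TensorPower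

variable (H : Type*) [NormedAddCommGroup H] [InnerProductSpace ℂ H] (n : ℕ)

/-- The algebraic tensor power, as a type of its own: it carries the Hilbert space inner product
and not one of the Banach space tensor seminorms. -/
def AlgTensorPower : Type _ := ⨂[ℂ] _ : Fin n, H

namespace AlgTensorPower

instance : AddCommGroup (AlgTensorPower H n) :=
  inferInstanceAs (AddCommGroup (⨂[ℂ] _ : Fin n, H))

instance : Module ℂ (AlgTensorPower H n) :=
  inferInstanceAs (Module ℂ (⨂[ℂ] _ : Fin n, H))

variable {H n}

/-- The elementary tensor `x₁ ⊗ ⋯ ⊗ xₙ`, as a multilinear map. -/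
def tprod : MultilinearMap ℂ (fun _ : Fin n => H) (AlgTensorPower H n) :=
  PiTensorProduct.tprod ℂ

/-- The linear functional with `y₁ ⊗ ⋯ ⊗ yₙ ↦ ∏ᵢ ⟪xᵢ, yᵢ⟫`. -/
def pairing (x : Fin n → H) : AlgTensorPower H n →ₗ[ℂ] ℂ :=
  PiTensorProduct.lift ((MultilinearMap.mkPiAlgebra ℂ (Fin n) ℂ).compLinearMap
    (fun i => (innerₛₗ ℂ (x i) : H →ₗ[ℂ] ℂ)))

theorem pairing_tprod (x y : Fin n → H) :
    pairing x (tprod y) = ∏ i, inner ℂ (x i) (y i) :=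
  (PiTensorProduct.lift.tprod _).trans (by simp)

theorem conj_pairing_tprod (x y : Fin n → H) :
    conj (pairing y (tprod x)) = pairing x (tprod y) := by
  simp [pairing_tprod]

theorem span_range_tprod :
    Submodule.span ℂ (Set.range (tprod : (Fin n → H) → AlgTensorPower H n)) = ⊤ :=
  PiTensorProduct.span_tprod_eq_top

/-- The form `(x, y) ↦ ⟪x, y⟫`, conjugate linear in `x` and linear in `y`, with
`⟪x₁ ⊗ ⋯ ⊗ xₙ, y₁ ⊗ ⋯ ⊗ yₙ⟫ = ∏ᵢ ⟪xᵢ, yᵢ⟫`; the argument `y` comes first here. -/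
def form : AlgTensorPower H n →ₗ[ℂ] (AlgTensorPower H n →ₗ⋆[ℂ] ℂ) :=
  PiTensorProduct.lift
    { toFun := fun y => (starLinearEquiv ℂ : ℂ ≃ₗ⋆[ℂ] ℂ).toLinearMap.comp (pairing y)
      map_update_add' := by
        intro _ m i a b
        refine LinearMap.ext_on_range (v := tprod) span_range_tprod fun x => ?_
        have h (y : Fin n → H) : star (pairing y (tprod x)) = pairing x (tprod y) :=
          conj_pairing_tprod x y
        have e := (tprod (H := H) (n := n)).map_update_add m i a b
        simp only [LinearMap.add_apply, LinearMap.comp_apply, LinearEquiv.coe_coe,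
          starLinearEquiv_apply, h]
        rw [← map_add, ← e]
      map_update_smul' := by
        intro _ m i c a
        refine LinearMap.ext_on_range (v := tprod) span_range_tprod fun x => ?_
        have h (y : Fin n → H) : star (pairing y (tprod x)) = pairing x (tprod y) :=
          conj_pairing_tprod x y
        have e := (tprod (H := H) (n := n)).map_update_smul m i c a
        simp only [LinearMap.smul_apply, LinearMap.comp_apply, LinearEquiv.coe_coe,
          starLinearEquiv_apply, h]
        rw [← map_smul, ← e] }

theorem form_tprod (x y : Fin n → H) :
    form (tprod y) (tprod x) = ∏ i, inner ℂ (x i) (y i) := by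
  have h : form (tprod y) =
      (starLinearEquiv ℂ : ℂ ≃ₗ⋆[ℂ] ℂ).toLinearMap.comp (pairing y) :=
    PiTensorProduct.lift.tprod _
  rw [h, ← pairing_tprod, ← conj_pairing_tprod]
  rfl

theorem conj_form (x y : AlgTensorPower H n) : conj (form x y) = form y x := by
  have hx : x ∈ Submodule.span ℂ (Set.range (tprod : (Fin n → H) → AlgTensorPower H n)) := by
    rw [span_range_tprod]; trivial
  have hy : y ∈ Submodule.span ℂ (Set.range (tprod : (Fin n → H) → AlgTensorPower H n)) := by
    rw [span_range_tprod]; trivial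
  induction hx, hy using Submodule.span_induction₂ with
  | mem_mem x y hx hy =>
    obtain ⟨a, rfl⟩ := hx
    obtain ⟨b, rfl⟩ := hy
    simp [form_tprod]
  | zero_left y hy => simp
  | zero_right x hx => simp
  | add_left x y z hx hy hz h1 h2 => simp [h1, h2]
  | add_right x y z hx hy hz h1 h2 => simp [h1, h2]
  | smul_left r x y hx hy h => simp [h]
  | smul_right r x y hx hy h => simp [h]

open scoped ComplexOrder in
theorem posSemidef_prod_inner {ι : Type*} [Finite ι] (a : ι → Fin n → H) (s : Finset (Fin n)) :
    (Matrix.of fun j k => ∏ i ∈ s, inner ℂ (a j i) (a k i)).PosSemidef := by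
  classical
  induction s using Finset.induction_on with
  | empty =>
    have h := Matrix.posSemidef_gram (𝕜 := ℂ) (fun _ : ι => (1 : ℂ))
    have e : (Matrix.of fun j k : ι => ∏ i ∈ (∅ : Finset (Fin n)), inner ℂ (a j i) (a k i)) =
        Matrix.gram ℂ (fun _ : ι => (1 : ℂ)) := by
      ext j k
      simp
    rw [e]
    exact h
  | insert i s hi ih =>
    have h := (Matrix.posSemidef_gram (𝕜 := ℂ) (fun j : ι => a j i)).hadamard ih
    have e : (Matrix.of fun j k : ι => ∏ i ∈ insert i s, inner ℂ (a j i) (a k i)) =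
        (Matrix.gram ℂ fun j => a j i).hadamard
          (Matrix.of fun j k => ∏ i ∈ s, inner ℂ (a j i) (a k i)) := by
      ext j k
      simp [Finset.prod_insert hi]
    rw [e]
    exact h

open scoped ComplexOrder in
theorem form_self_nonneg (x : AlgTensorPower H n) : 0 ≤ form x x := by
  have hx : x ∈ Submodule.span ℂ (Set.range (tprod : (Fin n → H) → AlgTensorPower H n)) := by
    rw [span_range_tprod]; trivial
  obtain ⟨c, rfl⟩ := (Finsupp.mem_span_range_iff_exists_finsupp).1 hx
  have h := (posSemidef_prod_inner (fun j : c.support => (j : Fin n → H))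
    Finset.univ).dotProduct_mulVec_nonneg (fun j => c j)
  convert h using 1
  simp only [Finsupp.sum, map_sum, map_smul, map_smulₛₗ, LinearMap.sum_apply,
    LinearMap.smul_apply, form_tprod, dotProduct, Matrix.mulVec, Matrix.of_apply,
    Finset.mul_sum, Pi.star_apply, smul_eq_mul]
  rw [Finset.sum_coe_sort c.support (fun j : Fin n → H => ∑ k : c.support,
    star (c j) * ((∏ i, inner ℂ (j i) ((k : Fin n → H) i)) * c k))]
  refine Finset.sum_congr rfl fun j _ => ?_
  rw [Finset.sum_coe_sort c.support (fun k : Fin n → H =>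
    star (c j) * ((∏ i, inner ℂ (j i) (k i)) * c k))]
  refine Finset.sum_congr rfl fun k _ => ?_
  simp only [starRingEnd_apply]
  ring

/-- The (pre-)inner product of the tensor power. -/
instance : PreInnerProductSpace.Core ℂ (AlgTensorPower H n) where
  inner x y := form y x
  conj_inner_symm x y := conj_form x y
  re_inner_nonneg x := (Complex.le_def.1 (form_self_nonneg x)).1
  add_left x y z := by simp
  smul_left x y r := by simp

instance : SeminormedAddCommGroup (AlgTensorPower H n) :=
  InnerProductSpace.Core.toSeminormedAddCommGroup (𝕜 := ℂ)

instance : InnerProductSpace ℂ (AlgTensorPower H n) :=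
  InnerProductSpace.ofCore _

theorem inner_tprod (x y : Fin n → H) :
    inner ℂ (tprod x) (tprod y) = ∏ i, inner ℂ (x i) (y i) :=
  form_tprod x y

end AlgTensorPower

/-- The Hilbert space tensor power `H^{⊗n}`: the completion of the algebraic tensor power for the
inner product `⟪x₁ ⊗ ⋯ ⊗ xₙ, y₁ ⊗ ⋯ ⊗ yₙ⟫ = ∏ᵢ ⟪xᵢ, yᵢ⟫`. -/
abbrev HilbertTensorPower : Type _ := UniformSpace.Completion (AlgTensorPower H n)

namespace HilbertTensorPower

variable {H n}

/-- The elementary tensor `x₁ ⊗ ⋯ ⊗ xₙ` in `H^{⊗n}`. -/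
def tprod (x : Fin n → H) : HilbertTensorPower H n :=
  ((AlgTensorPower.tprod x : AlgTensorPower H n) : HilbertTensorPower H n)

theorem inner_tprod (x y : Fin n → H) :
    inner ℂ (tprod x) (tprod y) = ∏ i, inner ℂ (x i) (y i) :=
  (UniformSpace.Completion.inner_coe _ _).trans (AlgTensorPower.inner_tprod x y)

theorem norm_eq_of_form_eq (f : AlgTensorPower H n →ₗ[ℂ] AlgTensorPower H n)
    (hf : ∀ x y : Fin n → H, AlgTensorPower.form (f (AlgTensorPower.tprod y))
      (f (AlgTensorPower.tprod x)) = ∏ i, inner ℂ (x i) (y i)) (x : AlgTensorPower H n) :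
    ‖f x‖ = ‖x‖ := by
  have key (x y : AlgTensorPower H n) :
      AlgTensorPower.form (f x) (f y) = AlgTensorPower.form x y := by
    have hx : x ∈ Submodule.span ℂ
        (Set.range (AlgTensorPower.tprod : (Fin n → H) → AlgTensorPower H n)) := by
      rw [AlgTensorPower.span_range_tprod]; trivial
    have hy : y ∈ Submodule.span ℂ
        (Set.range (AlgTensorPower.tprod : (Fin n → H) → AlgTensorPower H n)) := by
      rw [AlgTensorPower.span_range_tprod]; trivial
    induction hx, hy using Submodule.span_induction₂ with
    | mem_mem x y hx hy =>
      obtain ⟨a, rfl⟩ := hx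
      obtain ⟨b, rfl⟩ := hy
      rw [hf, AlgTensorPower.form_tprod]
    | zero_left y hy => simp
    | zero_right x hx => simp
    | add_left x y z hx hy hz h1 h2 => simp [h1, h2]
    | add_right x y z hx hy hz h1 h2 => simp [h1, h2]
    | smul_left r x y hx hy h => simp [h]
    | smul_right r x y hx hy h => simp [h]
  rw [norm_eq_sqrt_re_inner (𝕜 := ℂ), norm_eq_sqrt_re_inner (𝕜 := ℂ) x]
  exact congrArg (fun t => Real.sqrt (RCLike.re t)) (key x x)

/-- The extension to `H^{⊗n}` of a bijective linear isometry of the algebraic tensor power. -/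
def extend (f : AlgTensorPower H n ≃ₗ[ℂ] AlgTensorPower H n) (hf : ∀ x, ‖f x‖ = ‖x‖) :
    HilbertTensorPower H n ≃ₗᵢ[ℂ] HilbertTensorPower H n :=
  f.extendOfIsometry
    (UniformSpace.Completion.toComplₗᵢ (𝕜 := ℂ) (E := AlgTensorPower H n)).toLinearMap
    (UniformSpace.Completion.toComplₗᵢ (𝕜 := ℂ) (E := AlgTensorPower H n)).toLinearMap
    UniformSpace.Completion.denseRange_coe UniformSpace.Completion.denseRange_coe
    (fun x => by simpa using hf x)

theorem extend_coe (f : AlgTensorPower H n ≃ₗ[ℂ] AlgTensorPower H n) (hf : ∀ x, ‖f x‖ = ‖x‖)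
    (x : AlgTensorPower H n) :
    extend f hf (x : HilbertTensorPower H n) = ((f x : AlgTensorPower H n) : HilbertTensorPower H n) :=
  LinearEquiv.extendOfIsometry_eq ..

/-- `x₁ ⊗ ⋯ ⊗ xₙ ↦ Ux₁ ⊗ ⋯ ⊗ Uxₙ` on the algebraic tensor power. -/
def algMap (U : H ≃ₗᵢ[ℂ] H) (n : ℕ) : AlgTensorPower H n ≃ₗ[ℂ] AlgTensorPower H n :=
  PiTensorProduct.congr fun _ : Fin n => U.toLinearEquiv

theorem algMap_tprod (U : H ≃ₗᵢ[ℂ] H) (x : Fin n → H) :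
    algMap U n (AlgTensorPower.tprod x) = AlgTensorPower.tprod (fun i => U (x i)) :=
  PiTensorProduct.congr_tprod _ _

/-- `x₁ ⊗ ⋯ ⊗ xₙ ↦ x_{π(1)} ⊗ ⋯ ⊗ x_{π(n)}` on the algebraic tensor power. -/
def algPerm (π : Equiv.Perm (Fin n)) : AlgTensorPower H n ≃ₗ[ℂ] AlgTensorPower H n :=
  PiTensorProduct.reindex ℂ (fun _ : Fin n => H) π.symm

theorem algPerm_tprod (π : Equiv.Perm (Fin n)) (x : Fin n → H) :
    algPerm π (AlgTensorPower.tprod x) = AlgTensorPower.tprod (fun i => x (π i)) :=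
  PiTensorProduct.reindex_tprod _ _

/-- The unitary operator `U^{⊗n}` on `H^{⊗n}`: `U^{⊗n}(x₁ ⊗ ⋯ ⊗ xₙ) = Ux₁ ⊗ ⋯ ⊗ Uxₙ`. -/
def map (U : H ≃ₗᵢ[ℂ] H) (n : ℕ) : HilbertTensorPower H n ≃ₗᵢ[ℂ] HilbertTensorPower H n :=
  extend (algMap U n) (norm_eq_of_form_eq (algMap U n).toLinearMap fun x y => by
    simp [algMap_tprod, AlgTensorPower.form_tprod])

theorem map_tprod (U : H ≃ₗᵢ[ℂ] H) (x : Fin n → H) :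
    map U n (tprod x) = tprod (fun i => U (x i)) := by
  rw [map, tprod, extend_coe, algMap_tprod, tprod]

/-- The operator `U_π` on `H^{⊗n}`: `U_π(x₁ ⊗ ⋯ ⊗ xₙ) = x_{π(1)} ⊗ ⋯ ⊗ x_{π(n)}`. -/
def perm (π : Equiv.Perm (Fin n)) : HilbertTensorPower H n ≃ₗᵢ[ℂ] HilbertTensorPower H n :=
  extend (algPerm π) (norm_eq_of_form_eq (algPerm π).toLinearMap fun x y => by
    simp only [LinearEquiv.coe_coe, algPerm_tprod, AlgTensorPower.form_tprod]
    exact Equiv.prod_comp π fun i => inner ℂ (x i) (y i))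

theorem perm_tprod (π : Equiv.Perm (Fin n)) (x : Fin n → H) :
    perm π (tprod x) = tprod (fun i => x (π i)) := by
  rw [perm, tprod, extend_coe, algPerm_tprod, tprod]

theorem map_perm (U : H ≃ₗᵢ[ℂ] H) (π : Equiv.Perm (Fin n)) (x : HilbertTensorPower H n) :
    map U n (perm π x) = perm π (map U n x) := by
  induction x using UniformSpace.Completion.induction_on with
  | hp => exact isClosed_eq (by fun_prop) (by fun_prop)
  | ih x =>
    have h : (algMap U n).toLinearMap.comp (algPerm π).toLinearMap =
        (algPerm π).toLinearMap.comp (algMap U n).toLinearMap :=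
      LinearMap.ext_on_range (v := AlgTensorPower.tprod) AlgTensorPower.span_range_tprod
        fun y => by simp [algMap_tprod, algPerm_tprod]
    have hx : algMap U n (algPerm π x) = algPerm π (algMap U n x) := LinearMap.congr_fun h x
    simp only [map, perm, extend_coe, hx]

end HilbertTensorPower

/-- The symmetric tensor power `H^{⊙n}`: the elements of `H^{⊗n}` invariant under all `U_π`. -/
def symTensorPower : Submodule ℂ (HilbertTensorPower H n) where
  carrier := {x | ∀ π : Equiv.Perm (Fin n), HilbertTensorPower.perm π x = x}
  add_mem' hx hy π := by rw [map_add, hx π, hy π]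
  zero_mem' π := map_zero _
  smul_mem' c x hx π := by rw [map_smul, hx π]

variable {H} in
/-- The unitary operator `U^{⊙n}`, the restriction of `U^{⊗n}` to `H^{⊙n}`. -/
def symMap (U : H ≃ₗᵢ[ℂ] H) : symTensorPower H n ≃ₗᵢ[ℂ] symTensorPower H n where
  toFun x := ⟨HilbertTensorPower.map U n x, fun π => by
    rw [← HilbertTensorPower.map_perm, x.2 π]⟩
  invFun x := ⟨(HilbertTensorPower.map U n).symm x, fun π => by
    rw [LinearIsometryEquiv.eq_symm_apply, HilbertTensorPower.map_perm,
      LinearIsometryEquiv.apply_symm_apply, x.2 π]⟩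
  map_add' x y := by ext; simp
  map_smul' c x := by ext; simp
  left_inv x := by ext; simp
  right_inv x := by ext; simp
  norm_map' x := (HilbertTensorPower.map U n).norm_map x

end TensorPower

/-! ### Spectral theory of a unitary operator -/

section Spectral

variable {H : Type*} [NormedAddCommGroup H] [InnerProductSpace ℂ H]

/-- The cyclic space generated by `x`: the closed linear span of `Uⁿx`, `n ∈ ℤ`. -/
def cyclicSpace (U : H ≃ₗᵢ[ℂ] H) (x : H) : Submodule ℂ H :=
  (Submodule.span ℂ (Set.range fun n : ℤ => (U ^ n) x)).topologicalClosure

/-- `μ` is the spectral measure of `x`: the finite Borel measure on the circle with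
`⟨Uⁿx, x⟩ = ∫ zⁿ dμ(z)` for all `n ∈ ℤ`. The inner product of Mathlib is linear in its second
argument. -/
structure IsSpectralMeasure (U : H ≃ₗᵢ[ℂ] H) (x : H) (μ : Measure Circle) : Prop where
  finite : IsFiniteMeasure μ
  inner_eq : ∀ n : ℤ, inner ℂ x ((U ^ n) x) = ∫ z : Circle, ((z ^ n : Circle) : ℂ) ∂μ

/-- A spectral decomposition of `U`: `H` is the Hilbert sum of the cyclic spaces of the `x n`, and
the spectral measures `μ n` of the `x n` satisfy `μ 0 ≫ μ 1 ≫ ⋯`. The class of `μ 0` is then the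
maximal spectral type of `U`. -/
structure IsSpectralDecomposition (U : H ≃ₗᵢ[ℂ] H) (x : ℕ → H) (μ : ℕ → Measure Circle) :
    Prop where
  isSpectralMeasure : ∀ n, IsSpectralMeasure U (x n) (μ n)
  orthogonal : Pairwise fun i j => cyclicSpace U (x i) ⟂ cyclicSpace U (x j)
  dense : (⨆ n, cyclicSpace U (x n)).topologicalClosure = ⊤
  absolutelyContinuous : ∀ n, μ (n + 1) ≪ μ n

/-- The spectral multiplicity function `z ↦ ∑ₙ 1_{Aₙ}(z)`, where `Aₙ` is the set on which the
Radon-Nikodym derivative of `μ n` with respect to `μ 0` does not vanish. -/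
def spectralMultiplicity (μ : ℕ → Measure Circle) (z : Circle) : ℕ∞ :=
  {n : ℕ | (μ n).rnDeriv (μ 0) z ≠ 0}.encard

/-- `U` has homogeneous spectrum of multiplicity `N`: the spectral multiplicity function is equal
to `N` almost everywhere with respect to the maximal spectral type. -/
def HasHomogeneousSpectrum (U : H ≃ₗᵢ[ℂ] H) (N : ℕ) : Prop :=
  ∃ (x : ℕ → H) (μ : ℕ → Measure Circle), IsSpectralDecomposition U x μ ∧
    ∀ᵐ z ∂(μ 0), spectralMultiplicity μ z = N

/-- `U` has simple spectrum: homogeneous spectrum of multiplicity one. -/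
def HasSimpleSpectrum (U : H ≃ₗᵢ[ℂ] H) : Prop :=
  HasHomogeneousSpectrum U 1

end Spectral

/-! ### The multiplication operator -/

section Multiplication

variable (σ : Measure Circle)

theorem memLp_circle_mul {g : Circle → Circle} (hg : Continuous g) {f : Circle → ℂ}
    (hf : MemLp f 2 σ) : MemLp (fun z => (g z : ℂ) * f z) 2 σ := by
  refine hf.of_le ?_ (ae_of_all _ fun z => by simp [Circle.norm_coe])
  exact (continuous_subtype_val.comp hg).aestronglyMeasurable.mul hf.1

/-- Multiplication by a continuous circle valued function on `L²(𝕋, σ)`. -/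
def mulCircle (g : C(Circle, Circle)) : Lp ℂ 2 σ →ₗᵢ[ℂ] Lp ℂ 2 σ where
  toFun f := (memLp_circle_mul σ g.continuous (Lp.memLp f)).toLp _
  map_add' f f' := by
    rw [← MemLp.toLp_add]
    refine MemLp.toLp_congr _ _ ?_
    filter_upwards [Lp.coeFn_add f f'] with z hz
    rw [hz]
    exact mul_add _ _ _
  map_smul' c f := by
    rw [RingHom.id_apply, ← MemLp.toLp_const_smul]
    refine MemLp.toLp_congr _ _ ?_
    filter_upwards [Lp.coeFn_smul c f] with z hz
    simp [hz, mul_left_comm]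
  norm_map' f := by
    refine le_antisymm ?_ ?_
    · refine Lp.norm_le_norm_of_ae_le ?_
      filter_upwards [(memLp_circle_mul σ g.continuous (Lp.memLp f)).coeFn_toLp] with z hz
      exact (by simp [hz, Circle.norm_coe] : _ = _).le
    · refine Lp.norm_le_norm_of_ae_le ?_
      filter_upwards [(memLp_circle_mul σ g.continuous (Lp.memLp f)).coeFn_toLp] with z hz
      exact (by simp [hz, Circle.norm_coe] : _ = _).le

theorem coeFn_mulCircle (g : C(Circle, Circle)) (f : Lp ℂ 2 σ) :
    ∀ᵐ z ∂σ, mulCircle σ g f z = (g z : ℂ) * f z :=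
  (memLp_circle_mul σ g.continuous (Lp.memLp f)).coeFn_toLp

/-- The unitary operator `V_σ` on `L²(𝕋, σ)`: `(V_σ f)(z) = z f(z)`. -/
def mulOp : Lp ℂ 2 σ ≃ₗᵢ[ℂ] Lp ℂ 2 σ where
  toFun := mulCircle σ ⟨fun z => z, continuous_id⟩
  invFun := mulCircle σ ⟨fun z => z⁻¹, continuous_inv⟩
  map_add' := map_add _
  map_smul' := map_smul _
  left_inv f := by
    refine Lp.ext ?_
    filter_upwards [coeFn_mulCircle σ ⟨fun z => z, continuous_id⟩ f,
      coeFn_mulCircle σ ⟨fun z => z⁻¹, continuous_inv⟩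
        (mulCircle σ ⟨fun z => z, continuous_id⟩ f)] with z h1 h2
    rw [h2, h1]
    simp
  right_inv f := by
    refine Lp.ext ?_
    filter_upwards [coeFn_mulCircle σ ⟨fun z => z⁻¹, continuous_inv⟩ f,
      coeFn_mulCircle σ ⟨fun z => z, continuous_id⟩
        (mulCircle σ ⟨fun z => z⁻¹, continuous_inv⟩ f)] with z h1 h2
    rw [h2, h1]
    simp
  norm_map' := (mulCircle σ ⟨fun z => z, continuous_id⟩).norm_map

theorem coeFn_mulOp (f : Lp ℂ 2 σ) : ∀ᵐ z ∂σ, mulOp σ f z = (z : ℂ) * f z :=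
  coeFn_mulCircle σ ⟨fun z => z, continuous_id⟩ f

end Multiplication

end

noncomputable section

/-! ### Simple spectrum and cyclic vectors -/

/-! One `n ≥ 2k` with simple spectrum suffices. Viewed in `L²(σ^{⊗n})`, the operator multiplies by
`z₁⋯zₙ`, so a cyclic vector `X` writes every symmetric tensor as `p(z₁⋯zₙ) X(z)`. Comparing `f^{⊗n}`
with `1^{⊗n}` eliminates `X`: `∏ f(zᵢ)` is a function of `∏ zᵢ` (`exists_prod_eq_comp_prod`). For
`f(z) = t + 2 - z`, `t ∈ ℕ`, this says that almost surely the product determines the polynomial `∏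
(T - zᵢ)`, hence the multiset of roots. Freezing variables by Fubini gives the same for `2k` and for
`k` points, so `σ^{∗k}`-almost every `s` carries a `k`-element multiset `M(s)` with product `s`, and
`M(s) + M(s')` depends only on `ss'` (`exists_evalRoots_factorization`).

If `σ^{∗k}` is not singular to `ν₁ ∗ ⋯ ∗ νₖ₊₁`, these properties hold at `s = w₁⋯wₖ₊₁` on a set of
positive product measure. Sampling each coordinate three times puts a whole box in this set with
positive probability (`measure_pi_box_ne_zero`). Two samples span a cube and the third serves for
exchanges: exchanging one coordinate between two factors keeps `ss'`, so a move along an edge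
changes `M` by an amount that depends only on the direction. If all `k + 1` directions changed `M`,
each would remove some element, and moving along all of them would require `k + 1` elements in a
`k`-element multiset (`exists_singleton_eq_empty_of_separable`). So some direction leaves `M`, and
with it the product, unchanged; two independent samples of a continuous `νᵢ` then coincide, an event
of probability zero. -/

theorem IsSpectralMeasure.eq_zero {H : Type*} [NormedAddCommGroup H] [InnerProductSpace ℂ H]
    {U : H ≃ₗᵢ[ℂ] H} {x : H} (h : IsSpectralMeasure U x 0) : x = 0 := by
  have h0 := h.inner_eq 0
  simpa using h0

theorem cyclicSpace_zero {H : Type*} [NormedAddCommGroup H] [InnerProductSpace ℂ H]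
    (U : H ≃ₗᵢ[ℂ] H) : cyclicSpace U 0 = ⊥ := by
  have : (Set.range fun n : ℤ => (U ^ n) (0 : H)) = {0} := by
    ext y
    simp
  rw [cyclicSpace, this, Submodule.span_zero_singleton]
  exact (isClosed_singleton (x := (0 : H))).submodule_topologicalClosure_eq

/-- An operator with simple spectrum has a cyclic vector. -/
theorem HasSimpleSpectrum.exists_cyclicSpace_eq_top {H : Type*} [NormedAddCommGroup H]
    [InnerProductSpace ℂ H] {U : H ≃ₗᵢ[ℂ] H} (h : HasSimpleSpectrum U) :
    ∃ x, cyclicSpace U x = ⊤ := by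
  obtain ⟨x, μ, hd, hm⟩ := h
  have hfin (n : ℕ) : IsFiniteMeasure (μ n) := (hd.isSpectralMeasure n).finite
  have hac (n : ℕ) : μ n ≪ μ 0 := by
    induction n with
    | zero => exact Measure.AbsolutelyContinuous.rfl
    | succ n ih => exact (hd.absolutelyContinuous n).trans ih
  have hzero (n : ℕ) (hn : n ≠ 0) : x n = 0 := by
    -- The index `0` is always counted, since the density of `μ 0` against itself is `1`;
    -- multiplicity one leaves no room for another index.
    have hμ : μ n = 0 := by
      rw [← Measure.withDensity_rnDeriv_eq _ _ (hac n)]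
      rw [withDensity_eq_zero_iff (Measure.measurable_rnDeriv _ _).aemeasurable]
      filter_upwards [hm, (μ 0).rnDeriv_self] with z hz h0
      by_contra hne
      have h1 : ({n : ℕ | (μ n).rnDeriv (μ 0) z ≠ 0}).encard = 1 := by
        simpa [spectralMultiplicity] using hz
      obtain ⟨a, ha⟩ := Set.encard_eq_one.1 h1
      have e0 : (0 : ℕ) ∈ ({a} : Set ℕ) := by
        rw [← ha]
        simp [h0]
      have en : n ∈ ({a} : Set ℕ) := by
        rw [← ha]
        exact hne
      exact hn (Eq.trans en (Eq.symm e0))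
    have hs := hd.isSpectralMeasure n
    rw [hμ] at hs
    exact hs.eq_zero
  refine ⟨x 0, ?_⟩
  have hsup : (⨆ n, cyclicSpace U (x n)) = cyclicSpace U (x 0) := by
    refine le_antisymm (iSup_le fun n => ?_) (le_iSup (fun n => cyclicSpace U (x n)) 0)
    rcases eq_or_ne n 0 with rfl | hn
    · exact le_rfl
    · rw [hzero n hn, cyclicSpace_zero]
      exact bot_le
  rw [← hd.dense, hsup]
  exact ((Submodule.isClosed_topologicalClosure _).submodule_topologicalClosure_eq).symm

/-- A closed subspace containing a cyclic vector and stable under `U` and `U⁻¹` is everything. -/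
theorem mem_of_cyclicSpace_eq_top {H : Type*} [NormedAddCommGroup H] [InnerProductSpace ℂ H]
    {U : H ≃ₗᵢ[ℂ] H} {x : H} (hx : cyclicSpace U x = ⊤) (W : Submodule ℂ H)
    (hW : IsClosed (W : Set H)) (hxW : x ∈ W) (hU : ∀ y ∈ W, U y ∈ W)
    (hU' : ∀ y ∈ W, U.symm y ∈ W) (y : H) : y ∈ W := by
  have hz (n : ℤ) : (U ^ n) x ∈ W := by
    induction n using Int.induction_on with
    | zero => simpa using hxW
    | succ n ih =>
      rw [add_comm, zpow_one_add]
      exact hU _ ih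
    | pred n ih =>
      rw [sub_eq_add_neg, add_comm, zpow_add, zpow_neg_one]
      exact hU' _ ih
  have hle : cyclicSpace U x ≤ W := by
    refine Submodule.topologicalClosure_minimal _ (Submodule.span_le.2 ?_) hW
    rintro _ ⟨n, rfl⟩
    exact hz n
  exact hle (hx ▸ Submodule.mem_top)

/-! ### The tensor power of `L²` as a space of functions -/

section LpTensor

variable {X : Type*} [MeasurableSpace X] (σ : Measure X) [SigmaFinite σ] {n : ℕ}

theorem memLp_pi_prod {f : Fin n → X → ℂ} (hf : ∀ i, MemLp (f i) 2 σ) :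
    MemLp (fun z : Fin n → X => ∏ i, f i (z i)) 2 (Measure.pi fun _ => σ) := by
  have hm : AEStronglyMeasurable (fun z : Fin n → X => ∏ i, f i (z i))
      (Measure.pi fun _ => σ) := by
    refine Finset.aestronglyMeasurable_fun_prod _ fun i _ => ?_
    exact (hf i).1.comp_quasiMeasurePreserving (Measure.quasiMeasurePreserving_eval _ i)
  rw [memLp_two_iff_integrable_sq_norm hm]
  have h : Integrable (fun z : Fin n → X => ∏ i, ‖f i (z i)‖ ^ 2) (Measure.pi fun _ => σ) :=
    Integrable.fintype_prod (f := fun i x => ‖f i x‖ ^ 2) fun i =>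
      (memLp_two_iff_integrable_sq_norm (hf i).1).1 (hf i)
  refine h.congr (ae_of_all _ fun z => ?_)
  simp [Finset.prod_pow]

theorem ae_pi_eval {Y : Type*} {f g : X → Y} (i : Fin n) (h : f =ᵐ[σ] g) :
    ∀ᵐ z : Fin n → X ∂(Measure.pi fun _ => σ), f (z i) = g (z i) :=
  (Measure.quasiMeasurePreserving_eval (fun _ : Fin n => σ) i).ae h

/-- `(f₁, …, fₙ) ↦ f₁(z₁) ⋯ fₙ(zₙ)` as a multilinear map into `L²` of the product measure. -/
def lpProd : MultilinearMap ℂ (fun _ : Fin n => Lp ℂ 2 σ)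
    (Lp ℂ 2 (Measure.pi fun _ : Fin n => σ)) where
  toFun f := (memLp_pi_prod σ fun i => Lp.memLp (f i)).toLp _
  map_update_add' := by
    intro _ m i a b
    rw [← MemLp.toLp_add]
    refine MemLp.toLp_congr _ _ ?_
    filter_upwards [ae_pi_eval σ i (Lp.coeFn_add a b)] with z hz
    have h (c : Lp ℂ 2 σ) : ∏ j, Function.update m i c j (z j) =
        c (z i) * ∏ j ∈ Finset.univ.erase i, m j (z j) := by
      rw [← Finset.mul_prod_erase _ _ (Finset.mem_univ i), Function.update_self]
      congr 1
      refine Finset.prod_congr rfl fun j hj => ?_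
      rw [Function.update_of_ne (Finset.ne_of_mem_erase hj)]
    simp only [Pi.add_apply] at hz ⊢
    rw [h, h, h, hz, add_mul]
  map_update_smul' := by
    intro _ m i c a
    rw [← MemLp.toLp_const_smul]
    refine MemLp.toLp_congr _ _ ?_
    filter_upwards [ae_pi_eval σ i (Lp.coeFn_smul c a)] with z hz
    have h (c : Lp ℂ 2 σ) : ∏ j, Function.update m i c j (z j) =
        c (z i) * ∏ j ∈ Finset.univ.erase i, m j (z j) := by
      rw [← Finset.mul_prod_erase _ _ (Finset.mem_univ i), Function.update_self]
      congr 1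
      refine Finset.prod_congr rfl fun j hj => ?_
      rw [Function.update_of_ne (Finset.ne_of_mem_erase hj)]
    simp only [Pi.smul_apply] at hz ⊢
    rw [h, h, hz, smul_mul_assoc]

theorem coeFn_lpProd (f : Fin n → Lp ℂ 2 σ) :
    ∀ᵐ z ∂(Measure.pi fun _ : Fin n => σ), lpProd σ f z = ∏ i, f i (z i) :=
  (memLp_pi_prod σ fun i => Lp.memLp (f i)).coeFn_toLp

theorem inner_lpProd (f g : Fin n → Lp ℂ 2 σ) :
    inner ℂ (lpProd σ f) (lpProd σ g) = ∏ i, inner ℂ (f i) (g i) := by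
  simp only [L2.inner_def]
  rw [← integral_fintype_prod_eq_prod (μ := fun _ : Fin n => σ)
    (fun i x => inner ℂ (f i x) (g i x))]
  refine integral_congr_ae ?_
  filter_upwards [coeFn_lpProd σ f, coeFn_lpProd σ g] with z hf hg
  simp [hf, hg, Finset.prod_mul_distrib]

/-- The linear map of the algebraic tensor power of `L²` into `L²` of the product measure. -/
def algToLp : AlgTensorPower (Lp ℂ 2 σ) n →ₗ[ℂ] Lp ℂ 2 (Measure.pi fun _ : Fin n => σ) :=
  PiTensorProduct.lift (lpProd σ)

theorem algToLp_tprod (f : Fin n → Lp ℂ 2 σ) :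
    algToLp σ (AlgTensorPower.tprod f) = lpProd σ f :=
  PiTensorProduct.lift.tprod _

theorem inner_algToLp (x y : AlgTensorPower (Lp ℂ 2 σ) n) :
    inner ℂ (algToLp σ x) (algToLp σ y) = inner ℂ x y := by
  have hx : x ∈ Submodule.span ℂ (Set.range (AlgTensorPower.tprod (H := Lp ℂ 2 σ) (n := n))) := by
    rw [AlgTensorPower.span_range_tprod]; trivial
  have hy : y ∈ Submodule.span ℂ (Set.range (AlgTensorPower.tprod (H := Lp ℂ 2 σ) (n := n))) := by
    rw [AlgTensorPower.span_range_tprod]; trivial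
  induction hx, hy using Submodule.span_induction₂ with
  | mem_mem x y hx hy =>
    obtain ⟨a, rfl⟩ := hx
    obtain ⟨b, rfl⟩ := hy
    rw [algToLp_tprod, algToLp_tprod, inner_lpProd, AlgTensorPower.inner_tprod]
  | zero_left y hy => simp
  | zero_right x hx => simp
  | add_left x y z hx hy hz h1 h2 => simp [inner_add_left, h1, h2]
  | add_right x y z hx hy hz h1 h2 => simp [inner_add_right, h1, h2]
  | smul_left r x y hx hy h => simp [inner_smul_left, h]
  | smul_right r x y hx hy h => simp [inner_smul_right, h]

theorem norm_algToLp (x : AlgTensorPower (Lp ℂ 2 σ) n) : ‖algToLp σ x‖ = ‖x‖ := by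
  rw [norm_eq_sqrt_re_inner (𝕜 := ℂ), norm_eq_sqrt_re_inner (𝕜 := ℂ) x, inner_algToLp]

/-- The map of the Hilbert space tensor power of `L²` into `L²` of the product measure, with
`f₁ ⊗ ⋯ ⊗ fₙ ↦ f₁(z₁) ⋯ fₙ(zₙ)`. -/
def toLpPi : HilbertTensorPower (Lp ℂ 2 σ) n →L[ℂ] Lp ℂ 2 (Measure.pi fun _ : Fin n => σ) :=
  ((algToLp σ).mkContinuous 1 fun x => by rw [norm_algToLp, one_mul]).extend
    UniformSpace.Completion.toComplL

theorem toLpPi_coe (x : AlgTensorPower (Lp ℂ 2 σ) n) :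
    toLpPi σ (x : HilbertTensorPower (Lp ℂ 2 σ) n) = algToLp σ x :=
  ContinuousLinearMap.extend_eq _ UniformSpace.Completion.denseRange_coe
    (UniformSpace.Completion.isUniformInducing_coe _) x

theorem toLpPi_tprod (f : Fin n → Lp ℂ 2 σ) :
    toLpPi σ (HilbertTensorPower.tprod f) = lpProd σ f := by
  rw [HilbertTensorPower.tprod, toLpPi_coe, algToLp_tprod]

end LpTensor

/-! ### Relations preserved by limits in `L²` -/

/-- Almost everywhere limits of functions of the form `p (π z) * X z` are again of this form. -/
theorem exists_eq_comp_mul_of_tendsto_ae {Ω Y : Type*} [MeasurableSpace Ω] [MeasurableSpace Y]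
    {μ : Measure Ω} {π : Ω → Y} {X g : Ω → ℂ} {f : ℕ → Ω → ℂ}
    (hf : ∀ m, ∃ p : Y → ℂ, StronglyMeasurable p ∧ f m =ᵐ[μ] fun z => p (π z) * X z)
    (hg : ∀ᵐ z ∂μ, Filter.Tendsto (fun m => f m z) Filter.atTop (nhds (g z))) :
    ∃ p : Y → ℂ, StronglyMeasurable p ∧ g =ᵐ[μ] fun z => p (π z) * X z := by
  choose p hp hpf using hf
  -- The pointwise limit of the `p m`, with a default value where they diverge. They converge at `π
  -- z` as soon as `X z ≠ 0`; elsewhere the factor `X z` hides the value.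
  refine ⟨_, StronglyMeasurable.limUnder (l := Filter.atTop) hp, ?_⟩
  filter_upwards [hg, ae_all_iff.2 hpf] with z hz hpz
  simp only [hpz] at hz
  by_cases hX : X z = 0
  · simp only [hX, mul_zero] at hz ⊢
    exact tendsto_nhds_unique hz tendsto_const_nhds
  · have h2 := (hz.mul_const (X z)⁻¹).congr fun m => mul_inv_cancel_right₀ hX _
    rw [h2.limUnder_eq, inv_mul_cancel_right₀ hX]

/-- The relation `u = c v` almost everywhere is closed in `Lᵖ × Lᵖ`. -/
theorem isClosed_setOf_ae_eq_mul {Ω : Type*} [MeasurableSpace Ω] {μ : Measure Ω} (c : Ω → ℂ) :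
    IsClosed {w : Lp ℂ 2 μ × Lp ℂ 2 μ | ∀ᵐ z ∂μ, w.1 z = c z * w.2 z} := by
  refine IsSeqClosed.isClosed fun w v hw hv => ?_
  have h1 : Filter.Tendsto (fun m => (w m).1) Filter.atTop (nhds v.1) :=
    (continuous_fst.tendsto v).comp hv
  obtain ⟨a, ha, hat⟩ := (tendstoInMeasure_of_tendsto_Lp h1).exists_seq_tendsto_ae
  -- The second subsequence is extracted from the first, so both components converge almost
  -- everywhere along it.
  have h2 : Filter.Tendsto (fun m => (w (a m)).2) Filter.atTop (nhds v.2) :=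
    ((continuous_snd.tendsto v).comp hv).comp ha.tendsto_atTop
  obtain ⟨b, hb, hbt⟩ := (tendstoInMeasure_of_tendsto_Lp h2).exists_seq_tendsto_ae
  have hall : ∀ᵐ z ∂μ, ∀ m, (w m).1 z = c z * (w m).2 z := ae_all_iff.2 hw
  filter_upwards [hat, hbt, hall] with z hz1 hz2 hz
  refine tendsto_nhds_unique (hz1.comp hb.tendsto_atTop) ?_
  exact (hz2.const_mul (c z)).congr fun m => (hz _).symm

/-! ### Functional form of simple spectrum for `V_σ^{⊙n}` -/

section MulOp

variable (σ : Measure Circle) [IsFiniteMeasure σ] {n : ℕ}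

theorem toLpPi_map_mulOp (y : HilbertTensorPower (Lp ℂ 2 σ) n) :
    ∀ᵐ z ∂(Measure.pi fun _ : Fin n => σ),
      toLpPi σ (HilbertTensorPower.map (mulOp σ) n y) z =
        ((∏ i, z i : Circle) : ℂ) * toLpPi σ y z := by
  induction y using UniformSpace.Completion.induction_on with
  | hp =>
    have hc : Continuous fun y : HilbertTensorPower (Lp ℂ 2 σ) n =>
        (toLpPi σ (HilbertTensorPower.map (mulOp σ) n y), toLpPi σ y) := by fun_prop
    exact (isClosed_setOf_ae_eq_mul
      fun z : Fin n → Circle => ((∏ i, z i : Circle) : ℂ)).preimage hc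
  | ih x =>
    have hx : x ∈ Submodule.span ℂ
        (Set.range (AlgTensorPower.tprod (H := Lp ℂ 2 σ) (n := n))) := by
      rw [AlgTensorPower.span_range_tprod]; trivial
    induction hx using Submodule.span_induction with
    | mem x hx =>
      obtain ⟨f, rfl⟩ := hx
      change ∀ᵐ z ∂_, toLpPi σ (HilbertTensorPower.map (mulOp σ) n (HilbertTensorPower.tprod f)) z =
        _ * toLpPi σ (HilbertTensorPower.tprod f) z
      rw [HilbertTensorPower.map_tprod, toLpPi_tprod, toLpPi_tprod]
      filter_upwards [coeFn_lpProd σ f, coeFn_lpProd σ fun i => mulOp σ (f i),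
        ae_all_iff.2 fun i => ae_pi_eval (n := n) σ i (coeFn_mulOp σ (f i))] with z h1 h2 h3
      rw [h1, h2, Finset.prod_congr rfl fun i _ => h3 i, Finset.prod_mul_distrib]
      congr 1
      exact (map_prod Circle.coeHom _ _).symm
    | zero =>
      simp only [UniformSpace.Completion.coe_zero, map_zero]
      filter_upwards [Lp.coeFn_zero ℂ 2 (Measure.pi fun _ : Fin n => σ)] with z hz
      exact hz.trans (by rw [hz, Pi.zero_apply, mul_zero])
    | add x y _ _ hx hy =>
      simp only [UniformSpace.Completion.coe_add, map_add]
      filter_upwards [hx, hy, Lp.coeFn_add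
        (toLpPi σ (HilbertTensorPower.map (mulOp σ) n (x : HilbertTensorPower (Lp ℂ 2 σ) n)))
        (toLpPi σ (HilbertTensorPower.map (mulOp σ) n (y : HilbertTensorPower (Lp ℂ 2 σ) n))),
        Lp.coeFn_add (toLpPi σ (x : HilbertTensorPower (Lp ℂ 2 σ) n))
          (toLpPi σ (y : HilbertTensorPower (Lp ℂ 2 σ) n))] with z h1 h2 h3 h4
      rw [h3, h4, Pi.add_apply, Pi.add_apply, h1, h2, mul_add]
    | smul c x _ hx =>
      simp only [UniformSpace.Completion.coe_smul, map_smul]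
      filter_upwards [hx, Lp.coeFn_smul c
        (toLpPi σ (HilbertTensorPower.map (mulOp σ) n (x : HilbertTensorPower (Lp ℂ 2 σ) n))),
        Lp.coeFn_smul c (toLpPi σ (x : HilbertTensorPower (Lp ℂ 2 σ) n))] with z h1 h2 h3
      rw [h2, h3, Pi.smul_apply, Pi.smul_apply, h1, smul_eq_mul, smul_eq_mul, mul_left_comm]

/-- The symmetric tensors whose function is a function of the product times a given function. -/
def multiplesOf (X : (Fin n → Circle) → ℂ) : Submodule ℂ (symTensorPower (Lp ℂ 2 σ) n) where
  carrier := {y | ∃ p : Circle → ℂ, StronglyMeasurable p ∧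
    toLpPi σ (y : HilbertTensorPower (Lp ℂ 2 σ) n) =ᵐ[Measure.pi fun _ : Fin n => σ]
      fun z => p (∏ i, z i) * X z}
  add_mem' := by
    rintro y y' ⟨p, hp, hy⟩ ⟨p', hp', hy'⟩
    refine ⟨p + p', hp.add hp', ?_⟩
    rw [Submodule.coe_add, map_add]
    filter_upwards [hy, hy', Lp.coeFn_add
      (toLpPi σ (y : HilbertTensorPower (Lp ℂ 2 σ) n))
      (toLpPi σ (y' : HilbertTensorPower (Lp ℂ 2 σ) n))] with z h1 h2 h3
    rw [h3, Pi.add_apply, h1, h2, Pi.add_apply, add_mul]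
  zero_mem' := by
    refine ⟨0, stronglyMeasurable_zero, ?_⟩
    rw [Submodule.coe_zero, map_zero]
    filter_upwards [Lp.coeFn_zero ℂ 2 (Measure.pi fun _ : Fin n => σ)] with z hz
    exact hz.trans (by simp)
  smul_mem' := by
    rintro c y ⟨p, hp, hy⟩
    refine ⟨c • p, hp.const_smul c, ?_⟩
    rw [Submodule.coe_smul, map_smul]
    filter_upwards [hy, Lp.coeFn_smul c
      (toLpPi σ (y : HilbertTensorPower (Lp ℂ 2 σ) n))] with z h1 h2
    rw [h2, Pi.smul_apply, h1, Pi.smul_apply, smul_mul_assoc]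

theorem isClosed_multiplesOf (X : (Fin n → Circle) → ℂ) :
    IsClosed (multiplesOf σ X : Set (symTensorPower (Lp ℂ 2 σ) n)) := by
  refine IsSeqClosed.isClosed fun w y hw hy => ?_
  have h1 : Filter.Tendsto (fun m => toLpPi σ (w m : HilbertTensorPower (Lp ℂ 2 σ) n))
      Filter.atTop (nhds (toLpPi σ (y : HilbertTensorPower (Lp ℂ 2 σ) n))) :=
    (((toLpPi σ).continuous.comp continuous_subtype_val).tendsto y).comp hy
  obtain ⟨a, -, hat⟩ := (tendstoInMeasure_of_tendsto_Lp h1).exists_seq_tendsto_ae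
  exact exists_eq_comp_mul_of_tendsto_ae (fun m => hw (a m)) hat

theorem exists_eq_comp_mul_of_cyclicSpace_eq_top {x : symTensorPower (Lp ℂ 2 σ) n}
    (hx : cyclicSpace (symMap n (mulOp σ)) x = ⊤) (y : symTensorPower (Lp ℂ 2 σ) n) :
    ∃ p : Circle → ℂ, StronglyMeasurable p ∧
      toLpPi σ (y : HilbertTensorPower (Lp ℂ 2 σ) n) =ᵐ[Measure.pi fun _ : Fin n => σ]
        fun z => p (∏ i, z i) * toLpPi σ (x : HilbertTensorPower (Lp ℂ 2 σ) n) z := by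
  have hcoe : StronglyMeasurable fun s : Circle => (s : ℂ) :=
    (show Continuous fun s : Circle => (s : ℂ) from continuous_subtype_val).stronglyMeasurable
  refine mem_of_cyclicSpace_eq_top hx (multiplesOf σ (toLpPi σ x.1)) (isClosed_multiplesOf σ _)
    ⟨1, stronglyMeasurable_one, by simp⟩ ?_ ?_ y
  · rintro y ⟨p, hp, hy⟩
    refine ⟨fun s => s * p s, hcoe.mul hp, ?_⟩
    filter_upwards [hy, toLpPi_map_mulOp σ y.1] with z h1 h2
    rw [mul_assoc, ← h1, ← h2]
    rfl
  · rintro y ⟨p, hp, hy⟩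
    refine ⟨fun s => (s : ℂ)⁻¹ * p s, hcoe.measurable.inv.stronglyMeasurable.mul hp, ?_⟩
    have h := toLpPi_map_mulOp σ ((symMap n (mulOp σ)).symm y).1
    have e : HilbertTensorPower.map (mulOp σ) n ((symMap n (mulOp σ)).symm y).1 = y.1 :=
      congrArg Subtype.val ((symMap n (mulOp σ)).apply_symm_apply y)
    rw [e] at h
    filter_upwards [hy, h] with z h1 h2
    rw [mul_assoc, ← h1, h2, inv_mul_cancel_left₀ (Circle.coe_ne_zero _)]

/-- If `V_σ^{⊙n}` has simple spectrum, then `f(z₁) ⋯ f(zₙ)` depends only on `z₁ ⋯ zₙ`. -/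
theorem exists_prod_eq_comp_prod (h : HasSimpleSpectrum (symMap n (mulOp σ))) {f : Circle → ℂ}
    (hf : MemLp f 2 σ) :
    ∃ q : Circle → ℂ, Measurable q ∧
      ∀ᵐ z ∂(Measure.pi fun _ : Fin n => σ), ∏ i, f (z i) = q (∏ i, z i) := by
  obtain ⟨x, hx⟩ := h.exists_cyclicSpace_eq_top
  have key {g : Circle → ℂ} (hg : MemLp g 2 σ) : ∃ p : Circle → ℂ, StronglyMeasurable p ∧
      ∀ᵐ z ∂(Measure.pi fun _ : Fin n => σ), ∏ i, g (z i) =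
        p (∏ i, z i) * toLpPi σ (x : HilbertTensorPower (Lp ℂ 2 σ) n) z := by
    obtain ⟨p, hp, hpy⟩ := exists_eq_comp_mul_of_cyclicSpace_eq_top σ hx
      ⟨HilbertTensorPower.tprod fun _ => hg.toLp g, fun π => by
        rw [HilbertTensorPower.perm_tprod]⟩
    refine ⟨p, hp, ?_⟩
    rw [toLpPi_tprod] at hpy
    filter_upwards [hpy, coeFn_lpProd σ fun _ : Fin n => hg.toLp g,
      ae_all_iff.2 fun i => ae_pi_eval (n := n) σ i hg.coeFn_toLp] with z h1 h2 h3
    rw [← h1, h2]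
    exact Finset.prod_congr rfl fun i _ => (h3 i).symm
  obtain ⟨p, hp, hpf⟩ := key hf
  -- The constant `1` shows that the cyclic vector never vanishes (almost everywhere) and is itself
  -- the function `1 / p₁` of the product.
  obtain ⟨p₁, hp₁, hpf₁⟩ := key (memLp_const (1 : ℂ))
  refine ⟨fun s => p s * (p₁ s)⁻¹, hp.measurable.mul hp₁.measurable.inv, ?_⟩
  filter_upwards [hpf, hpf₁] with z h1 h2
  rw [h1]
  congr 1
  rw [Finset.prod_const_one] at h2
  exact eq_inv_of_mul_eq_one_right h2.symm

end MulOp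

/-! ### Splitting off variables -/

/-- The value at `t + 2` of the monic polynomial with roots `z₁, …, zₖ`. -/
def evalRoots {k : ℕ} (t : ℕ) (z : Fin k → Circle) : ℂ := ∏ i, ((t : ℂ) + 2 - z i)

/-- The points `t + 2` lie outside the unit circle, so values of `evalRoots` can be divided by. They
are countably many, so one null set serves for all `t`, yet infinitely many, so they determine a
polynomial. -/
theorem Circle.natCast_add_two_sub_coe_ne_zero (t : ℕ) (z : Circle) : (t : ℂ) + 2 - z ≠ 0 := by
  intro h
  have h1 : ‖((t + 2 : ℕ) : ℂ)‖ = ‖(z : ℂ)‖ := by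
    push_cast
    rw [sub_eq_zero.1 h]
  rw [Complex.norm_natCast, Circle.norm_coe] at h1
  norm_cast at h1
  omega

theorem evalRoots_ne_zero {k : ℕ} (t : ℕ) (z : Fin k → Circle) : evalRoots t z ≠ 0 :=
  Finset.prod_ne_zero_iff.2 fun i _ => Circle.natCast_add_two_sub_coe_ne_zero t (z i)

theorem continuous_evalRoots {k : ℕ} (t : ℕ) :
    Continuous (evalRoots t : (Fin k → Circle) → ℂ) := by
  refine continuous_finsetProd _ fun i _ => continuous_const.sub ?_
  exact (show Continuous fun s : Circle => (s : ℂ) from continuous_subtype_val).comp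
    (continuous_apply i)

theorem evalRoots_append {l m : ℕ} (t : ℕ) (y : Fin l → Circle) (z : Fin m → Circle) :
    evalRoots t (Fin.append y z) = evalRoots t y * evalRoots t z := by
  simp [evalRoots, Fin.prod_univ_add]

theorem prod_append_circle {l m : ℕ} (y : Fin l → Circle) (z : Fin m → Circle) :
    ∏ i, Fin.append y z i = (∏ i, y i) * ∏ i, z i := by
  simp [Fin.prod_univ_add]

theorem continuous_circle_prod (k : ℕ) : Continuous fun z : Fin k → Circle => ∏ i, z i :=
  continuous_finsetProd _ fun i _ => continuous_apply i

theorem measurable_circle_prod (k : ℕ) : Measurable fun z : Fin k → Circle => ∏ i, z i :=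
  (continuous_circle_prod k).measurable

theorem measurePreserving_append {X : Type*} [MeasurableSpace X] (σ : Measure X) [SigmaFinite σ]
    (l m : ℕ) :
    MeasurePreserving (fun w : (Fin l → X) × (Fin m → X) => Fin.append w.1 w.2)
      ((Measure.pi fun _ => σ).prod (Measure.pi fun _ => σ))
      (Measure.pi fun _ : Fin (l + m) => σ) := by
  have hm : Measurable (fun w : (Fin l → X) × (Fin m → X) => Fin.append w.1 w.2) := by
    refine measurable_pi_lambda _ fun i => ?_
    refine Fin.addCases (fun i => ?_) (fun i => ?_) i
    · simp only [Fin.append_left]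
      exact (measurable_pi_apply i).comp measurable_fst
    · simp only [Fin.append_right]
      exact (measurable_pi_apply i).comp measurable_snd
  refine ⟨hm, (Measure.pi_eq fun s hs => ?_).symm⟩
  rw [Measure.map_apply hm (MeasurableSet.univ_pi hs)]
  have e : (fun w : (Fin l → X) × (Fin m → X) => Fin.append w.1 w.2) ⁻¹' Set.univ.pi s =
      (Set.univ.pi fun i => s (Fin.castAdd m i)) ×ˢ (Set.univ.pi fun i => s (Fin.natAdd l i)) := by
    ext w
    simp only [Set.mem_preimage, Set.mem_pi, Set.mem_univ, true_implies, Set.mem_prod]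
    constructor
    · intro h
      exact ⟨fun i => by simpa using h (Fin.castAdd m i), fun i => by simpa using h (Fin.natAdd l i)⟩
    · rintro ⟨h1, h2⟩ i
      refine Fin.addCases (fun i => ?_) (fun i => ?_) i
      · simpa using h1 i
      · simpa using h2 i
  rw [e, Measure.prod_prod, Measure.pi_pi, Measure.pi_pi, Fin.prod_univ_add]

/-- By Fubini the first `l` variables can be frozen at a generic `y`, which exists because `σ ≠ 0`;
the nonzero factor `evalRoots t y` is then divided out. -/
theorem exists_evalRoots_eq_of_add (σ : Measure Circle) [IsFiniteMeasure σ] (hσ : σ ≠ 0)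
    {l m : ℕ} {q : ℕ → Circle → ℂ} (hq : ∀ t, Measurable (q t))
    (h : ∀ᵐ z ∂(Measure.pi fun _ : Fin (l + m) => σ), ∀ t, evalRoots t z = q t (∏ i, z i)) :
    ∃ a : ℕ → Circle → ℂ, (∀ t, Measurable (a t)) ∧
      ∀ᵐ z ∂(Measure.pi fun _ : Fin m => σ), ∀ t, evalRoots t z = a t (∏ i, z i) := by
  have hne : (Measure.pi fun _ : Fin l => σ) ≠ 0 := by
    intro h0
    have := congrArg (fun μ => μ Set.univ) h0
    simp [Measure.pi_univ, hσ] at this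
  have := ae_neBot.2 hne
  have h1 := Measure.ae_ae_of_ae_prod ((measurePreserving_append σ l m).quasiMeasurePreserving.ae h)
  obtain ⟨y, hy⟩ := h1.exists
  refine ⟨fun t s => (evalRoots t y)⁻¹ * q t ((∏ i, y i) * s), fun t => ?_, ?_⟩
  · exact ((hq t).comp (measurable_const_mul _)).const_mul _
  · filter_upwards [hy] with z hz t
    have hz := hz t
    rw [evalRoots_append, prod_append_circle] at hz
    rw [← hz, inv_mul_cancel_left₀ (evalRoots_ne_zero t y)]

instance convPow.instIsFiniteMeasure (σ : Measure Circle) [IsFiniteMeasure σ] (k : ℕ) :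
    IsFiniteMeasure (convPow σ k) := by
  rw [convPow, circleConv]
  infer_instance

/-- If `V_σ^{⊙n}` has simple spectrum for some `n ≥ 2k`, then the roots `z₁, …, zₖ` are determined
by their product, for almost all of them, and so are the pairs of such tuples. -/
theorem exists_evalRoots_factorization (σ : Measure Circle) [IsFiniteMeasure σ] (hσ : σ ≠ 0)
    {n k : ℕ} (hkn : k + k ≤ n) (h : HasSimpleSpectrum (symMap n (mulOp σ))) :
    ∃ a r : ℕ → Circle → ℂ,
      (∀ᵐ s ∂(convPow σ k), ∃ z : Fin k → Circle, ∏ i, z i = s ∧ ∀ t, a t s = evalRoots t z) ∧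
      ∀ᵐ s ∂((convPow σ k).prod (convPow σ k)), ∀ t, a t s.1 * a t s.2 = r t (s.1 * s.2) := by
  have hf (t : ℕ) : MemLp (fun s : Circle => (t : ℂ) + 2 - s) 2 σ := by
    have hc : Continuous (fun s : Circle => (t : ℂ) + 2 - s) :=
      continuous_const.sub continuous_subtype_val
    refine MemLp.of_bound hc.aestronglyMeasurable (‖(t : ℂ) + 2‖ + 1) (ae_of_all _ fun s => ?_)
    exact (norm_sub_le _ _).trans (by rw [Circle.norm_coe])
  choose q hq hqz using fun t => exists_prod_eq_comp_prod σ h (hf t)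
  obtain ⟨l, rfl⟩ := Nat.exists_eq_add_of_le' hkn
  -- `r` belongs to `2k` variables, `a` to `k` of them.
  obtain ⟨r, hr, hrz⟩ := exists_evalRoots_eq_of_add σ hσ hq (ae_all_iff.2 hqz)
  obtain ⟨a, ha, haz⟩ := exists_evalRoots_eq_of_add σ hσ hr hrz
  refine ⟨a, r, ?_, ?_⟩
  · let Φ : (Fin k → Circle) → Circle × (ℕ → ℂ) := fun z => (∏ i, z i, fun t => evalRoots t z)
    have hΦ : Continuous Φ :=
      (continuous_circle_prod k).prodMk (continuous_pi fun t => continuous_evalRoots t)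
    have hC : IsClosed (Set.range Φ) := (isCompact_range hΦ).isClosed
    have hm : Measurable fun s : Circle => (s, fun t => a t s) :=
      measurable_id.prodMk (measurable_pi_lambda _ ha)
    have e (s : Circle) : (∃ z : Fin k → Circle, ∏ i, z i = s ∧ ∀ t, a t s = evalRoots t z) ↔
        s ∈ (fun s : Circle => (s, fun t => a t s)) ⁻¹' Set.range Φ := by
      simp only [Set.mem_preimage, Set.mem_range, Φ, Prod.mk.injEq, funext_iff]
      simp only [eq_comm (a := a _ _)]
    simp only [e, convPow, circleConv]
    refine (ae_map_iff (measurable_circle_prod k).aemeasurable (hm hC.measurableSet)).2 ?_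
    filter_upwards [haz] with z hz
    exact (e _).1 ⟨z, rfl, fun t => (hz t).symm⟩
  · have hp := measurable_circle_prod k
    rw [convPow, circleConv, Measure.map_prod_map _ _ hp hp, ae_map_iff (hp.prodMap hp).aemeasurable]
    · have h1 : ∀ᵐ w ∂((Measure.pi fun _ : Fin k => σ).prod (Measure.pi fun _ : Fin k => σ)),
          ∀ t, evalRoots t w.1 = a t (∏ i, w.1 i) :=
        Measure.quasiMeasurePreserving_fst.ae haz
      have h2 : ∀ᵐ w ∂((Measure.pi fun _ : Fin k => σ).prod (Measure.pi fun _ : Fin k => σ)),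
          ∀ t, evalRoots t w.2 = a t (∏ i, w.2 i) :=
        Measure.quasiMeasurePreserving_snd.ae haz
      filter_upwards [h1, h2, (measurePreserving_append σ k k).quasiMeasurePreserving.ae hrz]
        with w hw1 hw2 hw t
      have hw := hw t
      rw [evalRoots_append, prod_append_circle] at hw
      simp only [Prod.map_fst, Prod.map_snd]
      rw [← hw1, ← hw2, hw]
    · rw [Set.ofPred_forall]
      refine MeasurableSet.iInter fun t => ?_
      exact measurableSet_eq_fun (((ha t).comp measurable_fst).mul ((ha t).comp measurable_snd))
        ((hr t).comp (measurable_fst.mul measurable_snd))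

/-! ### Boxes in sets of positive measure -/

/-- If each coordinate is sampled independently `|J|` times, then with positive probability all the
points of the resulting box belong to a given set of positive measure. -/
theorem measure_pi_box_ne_zero {X J : Type*} [MeasurableSpace X] [Fintype J] [Nonempty J] {n : ℕ}
    (ν : Fin n → Measure X) [∀ i, SigmaFinite (ν i)] {A : Set (Fin n → X)} (hA : MeasurableSet A)
    (h : Measure.pi ν A ≠ 0) :
    (Measure.pi fun i => Measure.pi fun _ : J => ν i)
      {w | ∀ c : Fin n → J, (fun i => w i (c i)) ∈ A} ≠ 0 := by
  induction n with
  | zero =>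
    obtain ⟨x, hx⟩ := nonempty_of_measure_ne_zero h
    have : {w : Fin 0 → J → X | ∀ c : Fin 0 → J, (fun i => w i (c i)) ∈ A} = Set.univ :=
      Set.eq_univ_of_forall fun w c => by rwa [Subsingleton.elim (fun i => w i (c i)) x]
    rw [this, Measure.pi_univ]
    simp
  | succ n ih =>
    contrapose! h
    -- Only the first coordinate is resampled here; the induction hypothesis, applied to the
    -- sections of `B`, resamples the others.
    let B : Set ((J → X) × (Fin n → X)) := {y | ∀ j, Fin.cons (y.1 j) y.2 ∈ A}
    have hcons : Measurable fun y : X × (Fin n → X) => (Fin.cons y.1 y.2 : Fin (n + 1) → X) := by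
      refine measurable_pi_lambda _ fun i => ?_
      refine Fin.cases ?_ (fun i => ?_) i
      · simpa using measurable_fst
      · simp only [Fin.cons_succ]
        exact (measurable_pi_apply i).comp measurable_snd
    have hB : MeasurableSet B := by
      have : B = ⋂ j, (fun y : (J → X) × (Fin n → X) => (y.1 j, y.2)) ⁻¹'
          ((fun y : X × (Fin n → X) => (Fin.cons y.1 y.2 : Fin (n + 1) → X)) ⁻¹' A) := by
        ext; simp [B]
      rw [this]
      refine MeasurableSet.iInter fun j => (Measurable.prodMk ?_ measurable_snd) (hcons hA)
      exact (measurable_pi_apply j).comp measurable_fst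
    let E : Set ((J → X) × (Fin n → J → X)) :=
      {y | ∀ c : Fin n → J, (y.1, fun i => y.2 i (c i)) ∈ B}
    have hE : MeasurableSet E := by
      rw [show E = ⋂ c : Fin n → J, (fun y : (J → X) × (Fin n → J → X) =>
        (y.1, fun i => y.2 i (c i))) ⁻¹' B by ext; simp [E]]
      refine MeasurableSet.iInter fun c => (measurable_fst.prodMk ?_) hB
      exact measurable_pi_lambda _ fun i =>
        (measurable_pi_apply (c i)).comp ((measurable_pi_apply i).comp measurable_snd)
    have hE0 : ((Measure.pi fun _ : J => ν 0).prod
        (Measure.pi fun i : Fin n => Measure.pi fun _ : J => ν i.succ)) E = 0 := by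
      have mp := measurePreserving_piFinSuccAbove (fun i => Measure.pi fun _ : J => ν i) 0
      refine (mp.measure_preimage hE.nullMeasurableSet).symm.trans ?_
      refine measure_mono_null ?_ h
      intro w hw c
      convert hw (fun i => c i.succ) (c 0) using 1
      funext i
      refine Fin.cases ?_ (fun i => ?_) i <;> rfl
    rw [Measure.measure_prod_null hE] at hE0
    have hB0 : ((Measure.pi fun _ : J => ν 0).prod (Measure.pi fun i : Fin n => ν i.succ)) B = 0 := by
      rw [Measure.measure_prod_null hB]
      filter_upwards [hE0] with x hx
      by_contra hne
      exact ih (fun i => ν i.succ) (measurable_prodMk_left hB) hne hx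
    rw [Measure.prod_apply_symm hB,
      lintegral_eq_zero_iff (measurable_measure_prodMk_right hB)] at hB0
    let A' : Set (X × (Fin n → X)) := (fun y => (Fin.cons y.1 y.2 : Fin (n + 1) → X)) ⁻¹' A
    have hA' : MeasurableSet A' := hcons hA
    have hA0 : ((ν 0).prod (Measure.pi fun i : Fin n => ν i.succ)) A' = 0 := by
      rw [Measure.prod_apply_symm hA', lintegral_eq_zero_iff (measurable_measure_prodMk_right hA')]
      filter_upwards [hB0] with y hy
      -- For fixed `y` the samples of the first coordinate are independent, so the section of `B`
      -- has the measure of the section of `A'` to the power `|J|`; one is null only if the other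
      -- is.
      have e : (fun x : J → X => (x, y)) ⁻¹' B =
          Set.univ.pi fun _ : J => (fun x : X => (x, y)) ⁻¹' A' := by
        ext x
        simp [B, A']
      rw [e, Measure.pi_pi, Finset.prod_const] at hy
      exact eq_zero_of_pow_eq_zero hy
    have mp := measurePreserving_piFinSuccAbove ν 0
    refine measure_mono_null ?_ ((mp.measure_preimage hA'.nullMeasurableSet).trans hA0)
    intro w hw
    change Fin.cons (w 0) (fun i : Fin n => w i.succ) ∈ A
    convert hw using 1
    exact Fin.cons_self_tail w

/-! ### Independent choices of coordinates -/

theorem measurePreserving_eval_pair {X J : Type*} [MeasurableSpace X] [Fintype J]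
    (ν : Measure X) [IsProbabilityMeasure ν] {a b : J} (hab : a ≠ b) :
    MeasurePreserving (fun x : J → X => (x a, x b)) (Measure.pi fun _ => ν) (ν.prod ν) := by
  classical
  have hm : Measurable fun x : J → X => (x a, x b) :=
    (measurable_pi_apply a).prodMk (measurable_pi_apply b)
  refine ⟨hm, (Measure.prod_eq fun s t hs ht => ?_).symm⟩
  rw [Measure.map_apply hm (hs.prod ht)]
  let u : J → Set X := Function.update (Function.update (fun _ => Set.univ) a s) b t
  have e : (fun x : J → X => (x a, x b)) ⁻¹' s ×ˢ t = Set.pi ({a, b} : Finset J) u := by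
    ext x
    simp [u, hab]
  rw [e, Measure.pi_pi_finset, Finset.prod_pair hab]
  simp [u, hab]

/-- Choices that differ in every coordinate use disjoint sets of samples and are therefore
independent. Hence relations known almost everywhere for the square of the product measure apply to
such pairs only. -/
theorem measurePreserving_choice_pair {X J : Type*} [MeasurableSpace X] [Fintype J] {n : ℕ}
    (ν : Fin n → Measure X) [∀ i, IsProbabilityMeasure (ν i)] {c d : Fin n → J}
    (h : ∀ i, c i ≠ d i) :
    MeasurePreserving (fun w : Fin n → J → X => ((fun i => w i (c i)), fun i => w i (d i)))
      (Measure.pi fun i => Measure.pi fun _ : J => ν i) ((Measure.pi ν).prod (Measure.pi ν)) :=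
  (measurePreserving_arrowProdEquivProdArrow X X (Fin n) ν ν).comp
    (measurePreserving_pi _ (fun i => (ν i).prod (ν i)) fun i =>
      measurePreserving_eval_pair (ν i) (h i))

theorem measurePreserving_choice {X J : Type*} [MeasurableSpace X] [Fintype J] {n : ℕ}
    (ν : Fin n → Measure X) [∀ i, IsProbabilityMeasure (ν i)] (c : Fin n → J) :
    MeasurePreserving (fun (w : Fin n → J → X) i => w i (c i))
      (Measure.pi fun i => Measure.pi fun _ : J => ν i) (Measure.pi ν) :=
  measurePreserving_pi _ ν fun i => measurePreserving_eval (fun _ : J => ν i) (c i)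

theorem ae_ne_of_nullSingletonClass {X J : Type*} [MeasurableSpace X] [MeasurableEq X] [Fintype J]
    {n : ℕ} (ν : Fin n → Measure X) [∀ i, IsProbabilityMeasure (ν i)]
    [∀ i, NullSingletonClass (ν i)] (i : Fin n) {a b : J} (hab : a ≠ b) :
    ∀ᵐ w ∂(Measure.pi fun i => Measure.pi fun _ : J => ν i), w i a ≠ w i b := by
  have h : ∀ᵐ p ∂((ν i).prod (ν i)), p.1 ≠ p.2 := by
    have hd : MeasurableSet {p : X × X | p.1 ≠ p.2} := measurableSet_diagonal.compl
    rw [Measure.ae_prod_iff_ae_ae hd]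
    refine ae_of_all _ fun x => ?_
    filter_upwards [(measure_eq_zero_iff_ae_notMem.1 (measure_singleton (μ := ν i) x))] with y hy
    exact fun hxy => hy hxy.symm
  have mp : MeasurePreserving (fun w : Fin n → J → X => (w i a, w i b))
      (Measure.pi fun i => Measure.pi fun _ : J => ν i) ((ν i).prod (ν i)) :=
    (measurePreserving_eval_pair (ν i) hab).comp
      (measurePreserving_eval (fun i => Measure.pi fun _ : J => ν i) i)
  exact mp.quasiMeasurePreserving.ae h

/-! ### Additively separable families of multisets -/

/-- A family of `k`-element multisets indexed by the subsets of a set with `k + 1` elements, such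
that the effect of adding `i` to the index does not depend on the index, is constant in some
direction. -/
theorem exists_singleton_eq_empty_of_separable {α : Type*} [DecidableEq α] {k : ℕ}
    (f : Finset (Fin (k + 1)) → Multiset α) (hcard : ∀ S, (f S).card = k)
    (hsep : ∀ i S, i ∉ S → f (insert i S) + f ∅ = f {i} + f S) : ∃ i, f {i} = f ∅ := by
  by_contra! hne
  -- Distinct multisets of equal size: something in `f ∅` loses multiplicity in `f {i}`.
  have hx (i : Fin (k + 1)) : ∃ x, (f {i}).count x < (f ∅).count x := by
    by_contra! h
    exact hne i (Multiset.eq_of_le_of_card_le (Multiset.le_iff_count.2 h)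
      (by rw [hcard, hcard])).symm
  choose x hx using hx
  -- By separability each `i ∈ S` removes at least one further copy of `y`, whatever was added
  -- before.
  have hcount (S : Finset (Fin (k + 1))) (y : α) (hS : ∀ i ∈ S, x i = y) :
      (f S).count y + S.card ≤ (f ∅).count y := by
    induction S using Finset.induction_on with
    | empty => simp
    | insert i S hi ih =>
      have h1 := ih fun j hj => hS j (Finset.mem_insert_of_mem hj)
      have h2 := congrArg (Multiset.count y) (hsep i S hi)
      have h3 := hx i
      rw [hS i (Finset.mem_insert_self i S)] at h3
      rw [Multiset.count_add, Multiset.count_add] at h2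
      rw [Finset.card_insert_of_notMem hi]
      omega
  -- The bound for the fibre of `x` over `y` is exactly the multiplicity inequality; the left side
  -- has `k + 1` elements, the right side `k`.
  have hle : (Finset.univ : Finset (Fin (k + 1))).val.map x ≤ f ∅ := by
    refine Multiset.le_iff_count.2 fun y => ?_
    have h := hcount (Finset.univ.filter fun i => y = x i) y (by simp [eq_comm])
    rw [Multiset.count_map]
    exact (Nat.le_add_left _ _).trans h
  have h := Multiset.card_le_card hle
  rw [hcard] at h
  simp at h

/-! ### Recovering multisets of roots from values of polynomials -/

theorem Multiset.eq_of_forall_prod_map_sub_eq {s s' : Multiset ℂ}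
    (h : ∀ t : ℕ, (s.map fun z => (t : ℂ) + 2 - z).prod = (s'.map fun z => (t : ℂ) + 2 - z).prod) :
    s = s' := by
  rw [← Polynomial.roots_multiset_prod_X_sub_C s, ← Polynomial.roots_multiset_prod_X_sub_C s']
  congr 1
  refine Polynomial.eq_of_infinite_eval_eq _ _ (Set.infinite_of_injective_forall_mem
    (f := fun t : ℕ => (t : ℂ) + 2) (fun a b hab => by simpa using hab) fun t => ?_)
  simpa [Polynomial.eval_multiset_prod, Multiset.map_map] using h t

/-- The multiset of the values of a finite family of points of the circle. -/
def rootMultiset {k : ℕ} (z : Fin k → Circle) : Multiset ℂ :=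
  Finset.univ.val.map fun i => (z i : ℂ)

theorem card_rootMultiset {k : ℕ} (z : Fin k → Circle) : (rootMultiset z).card = k := by
  simp [rootMultiset]

theorem prod_rootMultiset {k : ℕ} (z : Fin k → Circle) :
    (rootMultiset z).prod = ((∏ i, z i : Circle) : ℂ) :=
  (map_prod Circle.coeHom _ _).symm

theorem evalRoots_eq_prod_map {k : ℕ} (t : ℕ) (z : Fin k → Circle) :
    evalRoots t z = ((rootMultiset z).map fun x => (t : ℂ) + 2 - x).prod := by
  rw [rootMultiset, Multiset.map_map]
  rfl

theorem rootMultiset_add_eq {k : ℕ} {z₁ z₂ z₃ z₄ : Fin k → Circle}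
    (h : ∀ t, evalRoots t z₁ * evalRoots t z₂ = evalRoots t z₃ * evalRoots t z₄) :
    rootMultiset z₁ + rootMultiset z₂ = rootMultiset z₃ + rootMultiset z₄ := by
  refine Multiset.eq_of_forall_prod_map_sub_eq fun t => ?_
  simpa only [Multiset.map_add, Multiset.prod_add, ← evalRoots_eq_prod_map] using h t

/-- `k`-element multisets with product `∏ w i (c i)` cannot be separable in `k + 1` variables unless
one of the variables does not vary. -/
theorem exists_eq_of_evalRoots_factorization {k : ℕ} (w : Fin (k + 1) → Fin 3 → Circle)
    (a r : ℕ → Circle → ℂ)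
    (ha : ∀ c : Fin (k + 1) → Fin 3, ∃ z : Fin k → Circle, ∏ i, z i = ∏ i, w i (c i) ∧
      ∀ t, a t (∏ i, w i (c i)) = evalRoots t z)
    (hr : ∀ c d : Fin (k + 1) → Fin 3, (∀ i, c i ≠ d i) → ∀ t,
      a t (∏ i, w i (c i)) * a t (∏ i, w i (d i)) =
        r t ((∏ i, w i (c i)) * ∏ i, w i (d i))) :
    ∃ i, w i 0 = w i 1 := by
  choose z hz haz using ha
  have key (c d c' d' : Fin (k + 1) → Fin 3) (h : ∀ i, c i ≠ d i) (h' : ∀ i, c' i ≠ d' i)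
      (hp : ∀ i, w i (c i) * w i (d i) = w i (c' i) * w i (d' i)) :
      rootMultiset (z c) + rootMultiset (z d) = rootMultiset (z c') + rootMultiset (z d') := by
    refine rootMultiset_add_eq fun t => ?_
    rw [← haz, ← haz, ← haz, ← haz, hr c d h, hr c' d' h', ← Finset.prod_mul_distrib,
      ← Finset.prod_mul_distrib, Finset.prod_congr rfl fun i _ => hp i]
  let ch (S : Finset (Fin (k + 1))) (i : Fin (k + 1)) : Fin 3 := if i ∈ S then 1 else 0
  -- The samples `0` and `1` span the cube; the sample `2` gives a partner differing from every
  -- vertex in every coordinate.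
  let v : Fin (k + 1) → Fin 3 := fun _ => 2
  have hch (S : Finset (Fin (k + 1))) (i : Fin (k + 1)) : ch S i ≠ 2 := by
    simp only [ch]
    split_ifs <;> decide
  -- Exchanging the `i`-th coordinates of `ch S` and `v` keeps the total product, and the two
  -- choices still differ everywhere.
  have hswap (S : Finset (Fin (k + 1))) (i : Fin (k + 1)) :
      rootMultiset (z (ch S)) + rootMultiset (z v) =
        rootMultiset (z (Function.update (ch S) i 2)) +
          rootMultiset (z (Function.update v i (ch S i))) := by
    refine key _ _ _ _ (hch S) (fun j => ?_) fun j => ?_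
    · rcases eq_or_ne j i with rfl | hj
      · simpa using (hch S j).symm
      · simpa [hj] using hch S j
    · rcases eq_or_ne j i with rfl | hj
      · simp [v, mul_comm]
      · simp [hj]
  have hupd (S : Finset (Fin (k + 1))) (i : Fin (k + 1)) :
      Function.update (ch (insert i S)) i 2 = Function.update (ch S) i 2 := by
    funext j
    rcases eq_or_ne j i with rfl | hj
    · simp
    · simp [hj, ch]
  obtain ⟨i, hi⟩ := exists_singleton_eq_empty_of_separable (fun S => rootMultiset (z (ch S)))
    (fun S => card_rootMultiset _) fun i S hi => by
      have e1 := hswap (insert i S) i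
      have e2 := hswap S i
      have e3 := hswap {i} i
      have e4 := hswap ∅ i
      rw [hupd] at e1
      rw [← insert_empty_eq, hupd] at e3
      rw [show ch (insert i S) i = 1 by simp [ch]] at e1
      rw [show ch S i = 0 by simp [ch, hi]] at e2
      rw [show ch (insert i ∅) i = 1 by simp [ch]] at e3
      rw [show ch ∅ i = 0 by simp [ch]] at e4
      -- The vertex with coordinate `i` replaced by `2` is common to `e1` and `e2`, and likewise to
      -- `e3` and `e4`. Cancelling it, both differences equal the one between `update v i 1` and
      -- `update v i 0`.
      ext x
      have e1 := congrArg (Multiset.count x) e1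
      have e2 := congrArg (Multiset.count x) e2
      have e3 := congrArg (Multiset.count x) e3
      have e4 := congrArg (Multiset.count x) e4
      rw [← insert_empty_eq]
      simp only [Multiset.count_add] at e1 e2 e3 e4 ⊢
      omega
  refine ⟨i, ?_⟩
  have hp := congrArg Multiset.prod hi
  simp only [prod_rootMultiset, hz, Circle.coe_inj] at hp
  rw [← Finset.mul_prod_erase _ _ (Finset.mem_univ i),
    ← Finset.mul_prod_erase _ (fun j => w j (ch ∅ j)) (Finset.mem_univ i)] at hp
  have he : ∏ j ∈ Finset.univ.erase i, w j (ch {i} j) = ∏ j ∈ Finset.univ.erase i, w j (ch ∅ j) :=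
    Finset.prod_congr rfl fun j hj => by simp [ch, Finset.ne_of_mem_erase hj]
  rw [he] at hp
  simpa [ch] using (mul_right_cancel hp).symm

/-! ### Convolution singularity -/

/-- A measure which is not singular to `ρ` has a nonzero absolutely continuous restriction. -/
theorem exists_restrict_absolutelyContinuous {X : Type*} [MeasurableSpace X] {ρ ν : Measure X}
    [SigmaFinite ρ] [SigmaFinite ν] (h : ¬ ρ ⟂ₘ ν) :
    ∃ N, MeasurableSet N ∧ ν N ≠ 0 ∧ ν.restrict N ≪ ρ := by
  -- `N` is null for the singular part of `ν` and its complement is null for `ρ`, so `ν N = 0` would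
  -- make `ρ` and `ν` singular.
  obtain ⟨N, hN, h1, h2⟩ := Measure.mutuallySingular_singularPart ν ρ
  refine ⟨N, hN, fun h0 => h ⟨Nᶜ, hN.compl, h2, by rwa [compl_compl]⟩, ?_⟩
  rw [Measure.haveLebesgueDecomposition_add ν ρ, Measure.restrict_add,
    Measure.restrict_eq_zero.2 h1, zero_add]
  exact Measure.restrict_le_self.absolutelyContinuous.trans (withDensity_absolutelyContinuous _ _)

theorem mutuallySingular_convPow_of_isProbabilityMeasure (σ : Measure Circle) [IsFiniteMeasure σ]
    (hσ : σ ≠ 0) {n k : ℕ} (hkn : k + k ≤ n) (h : HasSimpleSpectrum (symMap n (mulOp σ)))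
    (ν : Fin (k + 1) → Measure Circle) [∀ i, IsProbabilityMeasure (ν i)]
    [∀ i, NullSingletonClass (ν i)] : convPow σ k ⟂ₘ circleConv ν := by
  by_contra hsing
  have hp := measurable_circle_prod (k + 1)
  have : IsFiniteMeasure (circleConv ν) := by
    rw [circleConv]
    infer_instance
  obtain ⟨N, hN, hN0, hac⟩ := exists_restrict_absolutelyContinuous hsing
  obtain ⟨a, r, ha, hr⟩ := exists_evalRoots_factorization σ hσ hkn h
  let A : Set (Fin (k + 1) → Circle) := (fun w => ∏ i, w i) ⁻¹' N
  have hA : MeasurableSet A := hp hN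
  have hA0 : Measure.pi ν A ≠ 0 := by rwa [circleConv, Measure.map_apply hp hN] at hN0
  have ha' : ∀ᵐ w ∂(Measure.pi ν), w ∈ A → ∃ z : Fin k → Circle, ∏ i, z i = ∏ i, w i ∧
      ∀ t, a t (∏ i, w i) = evalRoots t z :=
    ae_of_ae_map hp.aemeasurable ((ae_restrict_iff' hN).1 (hac.ae_le ha))
  have hr' : ∀ᵐ w ∂((Measure.pi ν).prod (Measure.pi ν)), (w.1 ∈ A ∧ w.2 ∈ A) →
      ∀ t, a t (∏ i, w.1 i) * a t (∏ i, w.2 i) = r t ((∏ i, w.1 i) * ∏ i, w.2 i) := by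
    have h1 : ∀ᵐ s ∂(((circleConv ν).restrict N).prod ((circleConv ν).restrict N)),
        ∀ t, a t s.1 * a t s.2 = r t (s.1 * s.2) := (hac.prod hac).ae_le hr
    rw [Measure.prod_restrict, ae_restrict_iff' (hN.prod hN), circleConv,
      Measure.map_prod_map _ _ hp hp] at h1
    exact ae_of_ae_map (hp.prodMap hp).aemeasurable h1
  -- Boxes inside `A` have positive measure; the rest shows that almost every such box has two equal
  -- samples, which is a null event.
  have hbox := measure_pi_box_ne_zero (J := Fin 3) ν hA hA0
  refine hbox (measure_eq_zero_iff_ae_notMem.2 ?_)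
  have h1 := ae_all_iff.2 fun c : Fin (k + 1) → Fin 3 =>
    (measurePreserving_choice ν c).quasiMeasurePreserving.ae ha'
  have h2 := ae_all_iff.2 fun c : {c : (Fin (k + 1) → Fin 3) × (Fin (k + 1) → Fin 3) //
      ∀ i, c.1 i ≠ c.2 i} => (measurePreserving_choice_pair ν c.2).quasiMeasurePreserving.ae hr'
  have h3 := ae_all_iff.2 fun i : Fin (k + 1) =>
    ae_ne_of_nullSingletonClass ν i (show (0 : Fin 3) ≠ 1 by decide)
  filter_upwards [h1, h2, h3] with w hw1 hw2 hw3 hw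
  obtain ⟨i, hi⟩ := exists_eq_of_evalRoots_factorization w a r (fun c => hw1 c (hw c))
    fun c d hcd => hw2 ⟨(c, d), hcd⟩ ⟨hw c, hw d⟩
  exact hw3 i hi

theorem pi_eq_smul_pi_normalized {X : Type*} [MeasurableSpace X] {n : ℕ} (ν : Fin n → Measure X)
    [∀ i, IsFiniteMeasure (ν i)] (h : ∀ i, ν i ≠ 0) :
    Measure.pi ν = (∏ i, ν i Set.univ) • Measure.pi fun i => (ν i Set.univ)⁻¹ • ν i := by
  have (i : Fin n) : NeZero (ν i) := ⟨h i⟩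
  refine Measure.pi_eq fun s _ => ?_
  rw [Measure.smul_apply, Measure.pi_pi, smul_eq_mul, ← Finset.prod_mul_distrib]
  refine Finset.prod_congr rfl fun i _ => ?_
  rw [Measure.smul_apply, smul_eq_mul, ← mul_assoc,
    ENNReal.mul_inv_cancel (by simpa using h i) (measure_ne_top _ _), one_mul]

theorem convPow_zero_measure {k : ℕ} (hk : 1 ≤ k) : convPow (0 : Measure Circle) k = 0 := by
  have : (Measure.pi fun _ : Fin k => (0 : Measure Circle)) = 0 := by
    rw [← Measure.measure_univ_eq_zero, Measure.pi_univ]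
    simp only [Measure.coe_zero, Pi.zero_apply, Finset.prod_const, Finset.card_univ,
      Fintype.card_fin]
    exact zero_pow (by omega)
  rw [convPow, circleConv, this, Measure.map_zero]

end

theorem mainTheorem5 (σ : Measure Circle) [IsFiniteMeasure σ] [NullSingletonClass σ]
    (h : {n : ℕ | HasSimpleSpectrum (symMap n (mulOp σ))}.Infinite) (k : ℕ) (hk : 1 ≤ k) :
    HasCS (convPow σ k) (k + 1) := by
  intro ν hfin hcont
  rcases eq_or_ne σ 0 with rfl | hσ
  · rw [convPow_zero_measure hk]
    exact Measure.MutuallySingular.zero_left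
  -- Nonzero factors are normalized to probability measures, which rescales the convolution only; a
  -- zero factor makes it vanish.
  by_cases hν : ∀ i, ν i ≠ 0
  · have (i : Fin (k + 1)) : NeZero (ν i) := ⟨hν i⟩
    have (i : Fin (k + 1)) : NullSingletonClass ((ν i Set.univ)⁻¹ • ν i) :=
      ⟨fun x => by simp⟩
    obtain ⟨n, hn, hkn⟩ := h.exists_gt (k + k)
    refine (mutuallySingular_convPow_of_isProbabilityMeasure σ hσ hkn.le hn
      fun i => (ν i Set.univ)⁻¹ • ν i).mono_ac Measure.AbsolutelyContinuous.rfl ?_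
    rw [circleConv, circleConv, pi_eq_smul_pi_normalized ν hν, Measure.map_smul]
    exact Measure.smul_absolutelyContinuous
  · push Not at hν
    obtain ⟨i, hi⟩ := hν
    have hz : Measure.pi ν = 0 := by
      rw [← Measure.measure_univ_eq_zero, Measure.pi_univ]
      exact Finset.prod_eq_zero (Finset.mem_univ i) (by simp [hi])
    rw [circleConv, hz, Measure.map_zero]
    exact Measure.MutuallySingular.zero_right
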